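/- **Tiles.** Take a square with corners $tl,tr,bl,br$ (top/bottom, left/right). A *top path* has one of four shapes; it consists of the top side of the square, from $tl$ to $tr$, and a second strand: * $D$: the side $tl\,tr$ and a second, parallel edge $tl\,tr$; * $A$: the side $tl\,tr$ and an edge from $tr$ to a new vertex inside the left side of the square; * $V$: the side $tl\,tr$ and an edge from $tl$ to a new vertex inside the right side of the square; * $B$: the top side is subdivided by a new vertex $m$; the edge $tl\,m$ is doubled, and $m$ is also joined to a new vertex inside the right side of the square. A *bottom path* of shape $D,A,V,B$ is a top path of that shape rotated by $180^\circ$. An *oriented picture* is one of the following $21$ plane graphs, each containing the left and right sides of the square: the $16$ pictures $P_tP_b$ with top path $P_t$ and bottom path $P_b$, $P_t,P_b\in\{A,B,D,V\}$ (if both paths have a new vertex inside the same vertical side, the one of the top path is the upper one); the four pictures $VIA$, $AIV$, $BIA$, $AIB$, obtained from $VA$, $AV$, $BA$, $AB$ by contracting the edge between the two new vertices inside the same vertical side; and the picture $H$, the square with one new vertex inside each of the left and right sides and an edge between these two. (Up to rotation by $180^\circ$ there are $13$ pictures.) There are two frames, $L$ and $dL$: the frame $L$ adds two vertices $a,c$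 and the edges $tl\,a$ and $br\,c$; the left wall, from bottom to top, is $(bl,a)$ and the right wall is $(c,tr)$. The frame $dL$ adds, moreover, a vertex $b$ and two parallel edges $tr\,b$, and its right wall is $(c,b)$. Inserting the $21$ oriented pictures into the two frames gives a set $\mathcal S$ of $42$ tiles. **Graphs.** A *large $3$-connected $2$-crossing-critical graph* is a graph $G$ obtained as follows from tiles $T_0,\dots,T_{2m}\in\mathcal S$, $m\ge 1$: reverse both walls of every tile of odd index; identify, term by term, the right wall of each tile with the left wall of the next one; identify the right wall of $T_{2m}$, reversed, with the left wall of $T_0$; finally suppress all vertices of degree $2$. The signature of a tile is the name of its picture followed by the name $L$ or $dL$ of its frame, the signature of $G$ is the concatenation of the signatures of $T_0,\dots,T_{2m}$, and $\#L$ is the number of letters $L$ in it; thus $\#L=2m+1$ is the number of tiles. Let $\gamma(G)$ be the domination number of $G$. **Theorem.** For every large $3$-connected $2$-crossing-critical graph $G$, $$\gamma(G)\ \ge\ \left\lceil \tfrac23\cdot \#L\right\rceil .$$ The bound is sharp: if $n\ge 1$ is odd and $G$ is given by the sequence of $3n$ tiles that repeats $DDL,\,DDL,\,AIVL$ exactly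 $n$ times, then $\gamma(G)=\lceil \tfrac23\cdot\#L\rceil=2n$. -/

import Mathlib

namespace TwoCrossing

/-! ### Multigraphs, suppression of degree-two vertices, domination -/

/-- A multigraph (parallel edges and loops allowed): every edge has two end vertices,
whose order is irrelevant. -/
structure MGraph where
  V : Type
  E : Type
  ends : E → V × V

/-- `u` and `v` are the ends of a common edge. -/
def MGraph.Adj (G : MGraph) (u v : G.V) : Prop :=
  ∃ e, G.ends e = (u, v) ∨ G.ends e = (v, u)

/-- The degree of a vertex: the number of edge ends at it (a loop counts twice). -/
noncomputable def MGraph.degree (G : MGraph) (v : G.V) : ℕ :=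
  Nat.card {e : G.E // (G.ends e).1 = v} + Nat.card {e : G.E // (G.ends e).2 = v}

/-- `G.Thread u v`: one gets from `u` to `v` along edges of `G` so that all vertices passed on the
way have degree two. -/
inductive MGraph.Thread (G : MGraph) (u : G.V) : G.V → Prop
  | edge {v : G.V} : G.Adj u v → G.Thread u v
  | step {w v : G.V} : G.Thread u w → G.degree w = 2 → G.Adj w v → G.Thread u v

/-- The graph obtained from `G` by suppressing all vertices of degree two: its vertices are the
other vertices of `G`, and an edge joins two of them if an edge of `G`, or a path of `G` whose
inner vertices have degree two, does. Parallel edges are replaced by single ones, which does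
not affect domination. -/
def MGraph.suppress (G : MGraph) : SimpleGraph {v : G.V // G.degree v ≠ 2} :=
  SimpleGraph.fromRel fun u v => G.Thread u.1 v.1

/-- `D` dominates `G`: every vertex is in `D` or has a neighbour in `D`. -/
def IsDominating {V : Type} (G : SimpleGraph V) (D : Finset V) : Prop :=
  ∀ v, ∃ u ∈ D, u = v ∨ G.Adj u v

/-- The domination number of a finite graph: the size of a smallest dominating set. -/
noncomputable def dominationNumber {V : Type} (G : SimpleGraph V) : ℕ :=
  sInf {k | ∃ D : Finset V, IsDominating G D ∧ D.card = k}

/-! ### Tiles -/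

/-- A tile: a graph with two disjoint sequences of `w` distinct vertices each, the left wall
and the right wall (both listed from bottom to top). -/
structure Tile (w : ℕ) where
  graph : MGraph
  left : Fin w → graph.V
  right : Fin w → graph.V
  left_injective : Function.Injective left
  right_injective : Function.Injective right
  left_ne_right : ∀ i j, left i ≠ right j

/-- Reverse a wall if the flag is set. -/
def reverseIf {w : ℕ} {α : Type} (b : Bool) (s : Fin w → α) : Fin w → α :=
  fun i => s (if b then i.rev else i)

theorem reverseIf_injective {w : ℕ} {α : Type} (b : Bool) {s : Fin w → α}
    (hs : Function.Injective s) : Function.Injective (reverseIf b s) := by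
  intro i j h
  have h' := hs h
  cases b
  · simpa using h'
  · simpa using h'

/-- Left-invert the tile if `l` is set, and right-invert it if `r` is set. -/
def Tile.invertIf {w : ℕ} (l r : Bool) (T : Tile w) : Tile w where
  graph := T.graph
  left := reverseIf l T.left
  right := reverseIf r T.right
  left_injective := reverseIf_injective l T.left_injective
  right_injective := reverseIf_injective r T.right_injective
  left_ne_right := fun _ _ => T.left_ne_right _ _

/-- In the cyclization of the join of `T 0, …, T (n - 1)`, the right wall of each tile is identified
term by term with the left wall of the next one, where the tile after the last is the first. -/
inductive Glue {w n : ℕ} [NeZero n] (T : Fin n → Tile w) :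
    (Σ i, (T i).graph.V) → (Σ i, (T i).graph.V) → Prop
  | mk (i : Fin n) (k : Fin w) : Glue T ⟨i, (T i).right k⟩ ⟨i + 1, (T (i + 1)).left k⟩

/-- The cyclization of the join of a sequence of tiles. Vertices are identified along
the walls; edges are never identified. -/
def cyclization {w n : ℕ} [NeZero n] (T : Fin n → Tile w) : MGraph where
  V := Quot (Glue T)
  E := Σ i, (T i).graph.E
  ends := fun e => (Quot.mk _ ⟨e.1, ((T e.1).graph.ends e.2).1⟩,
    Quot.mk _ ⟨e.1, ((T e.1).graph.ends e.2).2⟩)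

/-! ### The 42 tiles -/

/-- Names for the vertices of the tiles. -/
inductive Vtx
  /-- top left corner of the square -/
  | tl
  /-- top right corner of the square -/
  | tr
  /-- bottom left corner of the square -/
  | bl
  /-- bottom right corner of the square -/
  | br
  /-- vertex inside the left side where the top path is attached -/
  | lt
  /-- vertex inside the left side where the bottom path is attached -/
  | lb
  /-- vertex inside the right side where the top path is attached -/
  | rt
  /-- vertex inside the right side where the bottom path is attached -/
  | rb
  /-- vertex inside the top side -/
  | mt
  /-- vertex inside the bottom side -/
  | mb
  /-- upper vertex of the left wall, outside the square -/
  | wl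
  /-- lower vertex of the right wall, outside the square -/
  | wr
  /-- upper vertex of the right wall, outside the square (used only in the frame `dL`) -/
  | wd
  deriving DecidableEq

/-- Rotation of the square by 180 degrees. -/
def Vtx.rot : Vtx → Vtx
  | tl => br
  | br => tl
  | tr => bl
  | bl => tr
  | lt => rb
  | rb => lt
  | rt => lb
  | lb => rt
  | mt => mb
  | mb => mt
  | wl => wr
  | wr => wl
  | wd => wd

/-- The four shapes of a top path or a bottom path. -/
inductive PathShape
  | A | B | D | V

/-- A picture with a chosen orientation: the picture `H`, the picture with given top path and
bottom path, or one of the pictures in which the top path and the bottom path are attached at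
the same vertex of a vertical side. The rotation by 180 degrees fixes `H`, exchanges the two
shapes in `paths t b`, and exchanges `VIA` with `AIV` and `BIA` with `AIB`. -/
inductive Picture
  | H
  | paths (top bottom : PathShape)
  | VIA | AIV | BIA | AIB

/-- The two frames. -/
inductive Frame
  | L | dL

/-- A tile of the family is given by an oriented picture and a frame. -/
structure TileName where
  picture : Picture
  frame : Frame

open Vtx

/-- The edges of a path through the listed vertices. -/
def pathEdges (l : List Vtx) : List (Vtx × Vtx) := l.zip l.tail

namespace PathShape

/-- Top side of the square together with the second strand of the top path. -/
def edges : PathShape → List (Vtx × Vtx)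
  | D => [(tl, tr), (tl, tr)]
  | A => [(tl, tr), (lt, tr)]
  | V => [(tl, tr), (tl, rt)]
  | B => [(tl, mt), (tl, mt), (mt, tr), (mt, rt)]

/-- The vertex, if any, at which the top path is attached inside the left side. -/
def onLeft : PathShape → List Vtx
  | A => [lt]
  | _ => []

/-- The vertex, if any, at which the top path is attached inside the right side. -/
def onRight : PathShape → List Vtx
  | V => [rt]
  | B => [rt]
  | _ => []

end PathShape

/-- The edges of an oriented picture, including the four sides of the square. A bottom path is
a top path rotated by 180 degrees. -/
def Picture.edges : Picture → List (Vtx × Vtx)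
  | H => pathEdges [tl, lt, bl] ++ pathEdges [tr, rt, br] ++ [(tl, tr), (br, bl), (lt, rt)]
  | paths t b =>
      pathEdges ([tl] ++ t.onLeft ++ b.onRight.map rot ++ [bl]) ++
      pathEdges ([tr] ++ t.onRight ++ b.onLeft.map rot ++ [br]) ++
      t.edges ++ b.edges.map (Prod.map rot rot)
  | VIA => pathEdges [tl, bl] ++ pathEdges [tr, rt, br] ++
      [(tl, tr), (tl, rt)] ++ [(br, bl), (rt, bl)]
  | AIV => pathEdges [tl, lt, bl] ++ pathEdges [tr, br] ++
      [(tl, tr), (lt, tr)] ++ [(br, bl), (br, lt)]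
  | BIA => pathEdges [tl, bl] ++ pathEdges [tr, rt, br] ++
      [(tl, mt), (tl, mt), (mt, tr), (mt, rt)] ++ [(br, bl), (rt, bl)]
  | AIB => pathEdges [tl, lt, bl] ++ pathEdges [tr, br] ++
      [(tl, tr), (lt, tr)] ++ [(br, mb), (br, mb), (mb, bl), (mb, lt)]

/-- The edges which a frame adds to its square. -/
def Frame.edges : Frame → List (Vtx × Vtx)
  | L => [(tl, wl), (br, wr)]
  | dL => [(tl, wl), (br, wr), (tr, wd), (tr, wd)]

/-- The upper vertex of the right wall. -/
def Frame.rightTop : Frame → Vtx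
  | L => tr
  | dL => wd

def TileName.edges (T : TileName) : List (Vtx × Vtx) :=
  T.picture.edges ++ T.frame.edges

/-- The vertices which occur in a tile: those incident with one of its edges. -/
def TileName.HasVertex (T : TileName) (v : Vtx) : Prop :=
  ∃ e ∈ T.edges, e.1 = v ∨ e.2 = v

/-- The graph of a tile. -/
def TileName.graph (T : TileName) : MGraph where
  V := {v : Vtx // T.HasVertex v}
  E := Fin T.edges.length
  ends := fun i =>
    (⟨(T.edges.get i).1, _, List.get_mem _ i, Or.inl rfl⟩,
      ⟨(T.edges.get i).2, _, List.get_mem _ i, Or.inr rfl⟩)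

theorem TileName.hasVertex_bl (T : TileName) : T.HasVertex bl := by
  rcases T with ⟨p | ⟨t, b⟩, f⟩ <;> try cases t
  all_goals try cases b
  all_goals cases f
  all_goals
    simp [TileName.HasVertex, TileName.edges, Picture.edges, pathEdges, PathShape.edges,
      PathShape.onLeft, PathShape.onRight, Frame.edges, Vtx.rot]

theorem TileName.hasVertex_wl (T : TileName) : T.HasVertex wl := by
  refine ⟨(tl, wl), ?_, Or.inr rfl⟩
  rcases T with ⟨p, f⟩
  cases f <;> simp [TileName.edges, Frame.edges]

theorem TileName.hasVertex_wr (T : TileName) : T.HasVertex wr := by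
  refine ⟨(br, wr), ?_, Or.inr rfl⟩
  rcases T with ⟨p, f⟩
  cases f <;> simp [TileName.edges, Frame.edges]

theorem TileName.hasVertex_rightTop (T : TileName) : T.HasVertex T.frame.rightTop := by
  rcases T with ⟨p | ⟨t, b⟩, f⟩ <;> try cases t
  all_goals try cases b
  all_goals cases f
  all_goals
    simp [TileName.HasVertex, TileName.edges, Picture.edges, pathEdges, PathShape.edges,
      PathShape.onLeft, PathShape.onRight, Frame.edges, Vtx.rot, Frame.rightTop]

/-- The tile with the given name; its walls have two vertices each. -/
def TileName.tile (T : TileName) : Tile 2 where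
  graph := T.graph
  left := ![⟨bl, T.hasVertex_bl⟩, ⟨wl, T.hasVertex_wl⟩]
  right := ![⟨wr, T.hasVertex_wr⟩, ⟨T.frame.rightTop, T.hasVertex_rightTop⟩]
  left_injective := by
    intro i j h
    fin_cases i <;> fin_cases j <;>
      first | rfl | exact absurd (congrArg Subtype.val h) (fun h' => Vtx.noConfusion h')
  right_injective := by
    rcases T with ⟨p, f⟩
    intro i j h
    cases f <;> fin_cases i <;> fin_cases j <;>
      first | rfl | exact absurd (congrArg Subtype.val h) (fun h' => Vtx.noConfusion h')
  left_ne_right := by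
    rcases T with ⟨p, f⟩
    intro i j h
    cases f <;> fin_cases i <;> fin_cases j <;>
      first | rfl | exact absurd (congrArg Subtype.val h) (fun h' => Vtx.noConfusion h')

/-! ### The large 3-connected 2-crossing-critical graphs -/

/-- The multigraph obtained from tiles `T 0, …, T (2 m)`: every tile with an odd index is inverted
(on both sides), the tiles are joined, the join is right-inverted (so its last tile is), and
the result is cyclized. -/
def twistedCyclization {m : ℕ} (T : Fin (2 * m + 1) → TileName) : MGraph :=
  cyclization fun i =>
    (T i).tile.invertIf (decide (Odd i.val)) (decide (Odd i.val ∨ i = Fin.last (2 * m)))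

/-- The large 3-connected 2-crossing-critical graph given by a sequence of tiles:
the vertices of degree two of the twisted cyclization are suppressed. -/
def largeGraph {m : ℕ} (T : Fin (2 * m + 1) → TileName) :
    SimpleGraph {v : (twistedCyclization T).V // (twistedCyclization T).degree v ≠ 2} :=
  (twistedCyclization T).suppress

/-! ### Signatures -/

/-- The alphabet of signatures. -/
inductive Letter
  | L | d | A | B | D | H | I | V
  deriving DecidableEq

def PathShape.letter : PathShape → Letter
  | A => .A
  | B => .B
  | D => .D
  | V => .V

def Picture.signature : Picture → List Letter
  | H => [.H]
  | paths t b => [t.letter, b.letter]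
  | VIA => [.V, .I, .A]
  | AIV => [.A, .I, .V]
  | BIA => [.B, .I, .A]
  | AIB => [.A, .I, .B]

def Frame.signature : Frame → List Letter
  | L => [.L]
  | dL => [.d, .L]

def TileName.signature (T : TileName) : List Letter :=
  T.picture.signature ++ T.frame.signature

/-- The signature of the graph given by a sequence of tiles. -/
def signature {m : ℕ} (T : Fin (2 * m + 1) → TileName) : List Letter :=
  (List.ofFn fun i => (T i).signature).flatten

/-- `#L`: the number of occurrences of the letter `L` in the signature. -/
def numL {m : ℕ} (T : Fin (2 * m + 1) → TileName) : ℕ := (signature T).count Letter.L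

/-- The sequence of `3 (2 k + 1)` tiles that repeats `DDL`, `DDL`, `AIVL`. -/
def sharpSequence (k : ℕ) : Fin (2 * (3 * k + 1) + 1) → TileName := fun i =>
  if i.val % 3 = 2 then ⟨.AIV, .L⟩ else ⟨.paths .D .D, .L⟩

end TwoCrossing

namespace TwoCrossing
open Vtx

/-! ### Finite checks on the 42 tiles -/

/-! The parity flags make the twist uniform: at every junction `wr` of a tile is glued to `wl` of
the next, and the upper right wall vertex to the next `bl`. The former classes are exactly the
vertices of degree two (`degree_eq_two_iff`). So consecutive tiles share one vertex of the final
graph, and are otherwise linked only by the edge from `br` of a tile to `tl` of the next, which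
arises by suppression (`largeGraph_adj`).

For the lower bound, each chosen private vertex gives charge 1 to its tile and each chosen shared
vertex gives 1/2 to both of its tiles. Tiles with too little charge receive some from their
neighbours, after which every tile has at least 2/3 (`discharging`). The only facts needed are
local: `tl` and `br` are never adjacent in a tile, nor are its two shared vertices, so a tile poor
in chosen vertices forces chosen private vertices in its neighbours (`RepDominating.two_mul_le`).

For sharpness, two vertices dominate each period `DDL`, `DDL`, `AIVL`: the one shared by the two
`DDL` tiles and the vertex `lt` of `AIVL`. -/

theorem Vtx.finite : Finite Vtx := by
  refine Set.finite_univ_iff.mp ((Finset.finite_toSet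
    {tl, tr, bl, br, lt, lb, rt, rb, mt, mb, wl, wr, wd}).subset fun v _ => ?_)
  cases v <;> simp

/-- Two vertex names are the ends of an edge of the tile. -/
def TileName.TAdj (T : TileName) (u v : Vtx) : Prop := (u, v) ∈ T.edges ∨ (v, u) ∈ T.edges

instance (T : TileName) (u v : Vtx) : Decidable (T.TAdj u v) :=
  inferInstanceAs (Decidable (_ ∨ _))

theorem TileName.TAdj.symm {T : TileName} {u v : Vtx} (h : T.TAdj u v) : T.TAdj v u := Or.symm h

theorem TileName.TAdj.hasVertex {T : TileName} {u v : Vtx} (h : T.TAdj u v) : T.HasVertex u :=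
  h.elim (fun h => ⟨_, h, Or.inl rfl⟩) fun h => ⟨_, h, Or.inr rfl⟩

/-- The number of edge ends at `v`. -/
def endCount (l : List (Vtx × Vtx)) (v : Vtx) : ℕ :=
  (l.map fun e => (if e.1 = v then 1 else 0) + if e.2 = v then 1 else 0).sum

/-- Replaces quantification over tiles by explicit lists, so that `decide` can check all 42 cases.
-/
theorem TileName.forall_of_lists {P : TileName → Prop}
    (h : ∀ p ∈ [Picture.H, .VIA, .AIV, .BIA, .AIB] ++
      [PathShape.A, .B, .D, .V].flatMap fun t => [PathShape.A, .B, .D, .V].map (Picture.paths t),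
      ∀ f ∈ [Frame.L, .dL], P ⟨p, f⟩) (T : TileName) : P T := by
  rcases T with ⟨p, f⟩
  refine h p ?_ f (by cases f <;> simp)
  rcases p with _ | ⟨t, b⟩ <;> try simp
  cases t <;> cases b <;> simp

theorem Vtx.forall_of_list {P : Vtx → Prop}
    (h : ∀ v ∈ [tl, tr, bl, br, lt, lb, rt, rb, mt, mb, wl, wr, wd], P v) (v : Vtx) : P v :=
  h v (by cases v <;> simp)

theorem TileName.tAdj_tl_wl (T : TileName) : T.TAdj tl wl := by
  revert T; apply TileName.forall_of_lists; decide

theorem TileName.tAdj_br_wr (T : TileName) : T.TAdj br wr := by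
  revert T; apply TileName.forall_of_lists; decide

theorem TileName.eq_tl_of_tAdj_wl (T : TileName) (v : Vtx) (h : T.TAdj wl v) : v = tl := by
  revert h v; revert T; apply TileName.forall_of_lists
  intro p hp f hf; apply Vtx.forall_of_list; revert p f; decide

theorem TileName.eq_br_of_tAdj_wr (T : TileName) (v : Vtx) (h : T.TAdj wr v) : v = br := by
  revert h v; revert T; apply TileName.forall_of_lists
  intro p hp f hf; apply Vtx.forall_of_list; revert p f; decide

/-- This non-adjacency and the next one are what the discharging needs to know about the inside of a
picture. -/
theorem TileName.not_tAdj_tl_br (T : TileName) : ¬ T.TAdj tl br := by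
  revert T; apply TileName.forall_of_lists; decide

theorem TileName.not_tAdj_bl_rightTop (T : TileName) : ¬ T.TAdj bl T.frame.rightTop := by
  revert T; apply TileName.forall_of_lists; decide

theorem TileName.endCount_wl (T : TileName) : endCount T.edges wl = 1 := by
  revert T; apply TileName.forall_of_lists; decide

theorem TileName.endCount_wr (T : TileName) : endCount T.edges wr = 1 := by
  revert T; apply TileName.forall_of_lists; decide

theorem TileName.two_le_endCount_bl (T : TileName) : 2 ≤ endCount T.edges bl := by
  revert T; apply TileName.forall_of_lists; decide

theorem TileName.two_le_endCount_rightTop (T : TileName) :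
    2 ≤ endCount T.edges T.frame.rightTop := by
  revert T; apply TileName.forall_of_lists; decide

theorem TileName.three_le_endCount (T : TileName) (v : Vtx) (h : T.HasVertex v) (hbl : v ≠ bl)
    (hwl : v ≠ wl) (hwr : v ≠ wr) (hr : v ≠ T.frame.rightTop) : 3 ≤ endCount T.edges v := by
  -- The hypotheses become alternatives of one decidable disjunction, ready for the exhaustive
  -- check.
  suffices h' : v = bl ∨ v = wl ∨ v = wr ∨ v = T.frame.rightTop ∨ 3 ≤ endCount T.edges v ∨
      ∀ e ∈ T.edges, ¬ (e.1 = v ∨ e.2 = v) by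
    rcases h' with h' | h' | h' | h' | h' | h'
    · exact absurd h' hbl
    · exact absurd h' hwl
    · exact absurd h' hwr
    · exact absurd h' hr
    · exact h'
    · obtain ⟨e, he, hv⟩ := h
      exact absurd hv (h' e he)
  clear h hbl hwl hwr hr
  revert v; revert T; apply TileName.forall_of_lists
  intro p hp f hf; apply Vtx.forall_of_list; revert p f
  decide

theorem TileName.rightTop_ne (T : TileName) {v : Vtx} (h1 : v ≠ tr) (h2 : v ≠ wd) :
    v ≠ T.frame.rightTop := by
  rcases T with ⟨p, f⟩
  cases f
  · exact h1
  · exact h2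

/-! ### Vertices of the twisted cyclization -/

section Model

variable {m : ℕ} (T : Fin (2 * m + 1) → TileName)

/-- The representative of a vertex `v` of tile `i` under the identification of walls: vertices on
a right wall are replaced by those of the left wall of the next tile. -/
def glueRep (p : Fin (2 * m + 1) × Vtx) : Fin (2 * m + 1) × Vtx :=
  if p.2 = wr then (p.1 + 1, wl)
  else if p.2 = (T p.1).frame.rightTop then (p.1 + 1, bl) else p

theorem glueRep_wr (i : Fin (2 * m + 1)) : glueRep T (i, wr) = (i + 1, wl) := by
  simp [glueRep]

theorem glueRep_rightTop (i : Fin (2 * m + 1)) :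
    glueRep T (i, (T i).frame.rightTop) = (i + 1, bl) := by
  have : (T i).frame.rightTop ≠ wr := by cases (T i).frame <;> simp [Frame.rightTop]
  simp [glueRep, this]

theorem glueRep_of_ne (i : Fin (2 * m + 1)) {v : Vtx} (h1 : v ≠ wr)
    (h2 : v ≠ (T i).frame.rightTop) : glueRep T (i, v) = (i, v) := by
  simp [glueRep, h1, h2]

theorem glueRep_cases (i : Fin (2 * m + 1)) (v : Vtx) :
    (v = wr ∧ glueRep T (i, v) = (i + 1, wl)) ∨
    (v = (T i).frame.rightTop ∧ glueRep T (i, v) = (i + 1, bl)) ∨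
    (v ≠ wr ∧ v ≠ (T i).frame.rightTop ∧ glueRep T (i, v) = (i, v)) := by
  by_cases h1 : v = wr
  · subst h1; exact Or.inl ⟨rfl, glueRep_wr T i⟩
  by_cases h2 : v = (T i).frame.rightTop
  · subst h2; exact Or.inr (Or.inl ⟨rfl, glueRep_rightTop T i⟩)
  · exact Or.inr (Or.inr ⟨h1, h2, glueRep_of_ne T i h1 h2⟩)

theorem glueRep_tl (i : Fin (2 * m + 1)) : glueRep T (i, tl) = (i, tl) :=
  glueRep_of_ne T i (by decide) ((T i).rightTop_ne (by decide) (by decide))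

theorem glueRep_br (i : Fin (2 * m + 1)) : glueRep T (i, br) = (i, br) :=
  glueRep_of_ne T i (by decide) ((T i).rightTop_ne (by decide) (by decide))

theorem glueRep_bl (i : Fin (2 * m + 1)) : glueRep T (i, bl) = (i, bl) :=
  glueRep_of_ne T i (by decide) ((T i).rightTop_ne (by decide) (by decide))

theorem glueRep_wl (i : Fin (2 * m + 1)) : glueRep T (i, wl) = (i, wl) :=
  glueRep_of_ne T i (by decide) ((T i).rightTop_ne (by decide) (by decide))

/-- The only vertices represented by the `v` of tile `j`, if `v` is not on a left wall. -/
theorem eq_of_glueRep_eq {i j : Fin (2 * m + 1)} {u v : Vtx} (h : glueRep T (i, u) = (j, v))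
    (h1 : v ≠ wl) (h2 : v ≠ bl) : i = j ∧ u = v := by
  rcases glueRep_cases T i u with ⟨_, h'⟩ | ⟨_, h'⟩ | ⟨_, _, h'⟩ <;> rw [h'] at h <;>
    simp only [Prod.mk.injEq] at h
  · exact absurd h.2.symm h1
  · exact absurd h.2.symm h2
  · exact h

theorem eq_of_glueRep_eq_wl {i j : Fin (2 * m + 1)} {u : Vtx} (h : glueRep T (i, u) = (j, wl)) :
    (i = j ∧ u = wl) ∨ (i + 1 = j ∧ u = wr) := by
  rcases glueRep_cases T i u with ⟨hu, h'⟩ | ⟨_, h'⟩ | ⟨_, _, h'⟩ <;> rw [h'] at h <;>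
    simp only [Prod.mk.injEq] at h
  · exact Or.inr ⟨h.1, hu⟩
  · exact absurd h.2 (by decide)
  · exact Or.inl h

theorem eq_of_glueRep_eq_bl {i j : Fin (2 * m + 1)} {u : Vtx} (h : glueRep T (i, u) = (j, bl)) :
    (i = j ∧ u = bl) ∨ (i + 1 = j ∧ u = (T i).frame.rightTop) := by
  rcases glueRep_cases T i u with ⟨hu, h'⟩ | ⟨hu, h'⟩ | ⟨_, _, h'⟩ <;> rw [h'] at h <;>
    simp only [Prod.mk.injEq] at h
  · exact absurd h.2 (by decide)
  · exact Or.inr ⟨h.1, hu⟩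
  · exact Or.inl h

/-- The tiles of the twisted cyclization, after inversion. -/
abbrev invertedTile (i : Fin (2 * m + 1)) : Tile 2 :=
  (T i).tile.invertIf (decide (Odd i.val)) (decide (Odd i.val ∨ i = Fin.last (2 * m)))

/-- At every junction exactly one of the two walls is reversed. This includes the closing one, where
the last index is even, its right wall carries the extra reversal, and tile 0 is not inverted. Hence
the gluing is the same everywhere and `glueRep` needs no parity. -/
theorem odd_add_one_iff (i : Fin (2 * m + 1)) :
    decide (Odd (i + 1).val) = !decide (Odd i.val ∨ i = Fin.last (2 * m)) := by
  by_cases h : i = Fin.last (2 * m)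
  · subst h; simp
  · have : (i + 1).val = i.val + 1 := Fin.val_add_one_of_lt (Fin.lt_last_iff_ne_last.mpr h)
    by_cases h' : Odd i.val <;> simp [this, h, Nat.odd_add_one, h', ← Nat.not_odd_iff_even]

theorem glueRep_respects (x y : Σ i, (invertedTile T i).graph.V)
    (h : Glue (invertedTile T) x y) :
    glueRep T (x.1, (x.2 : {v : Vtx // (T x.1).HasVertex v}).1) =
      glueRep T (y.1, (y.2 : {v : Vtx // (T y.1).HasVertex v}).1) := by
  obtain ⟨i, k⟩ := h
  have hf := odd_add_one_iff i
  change glueRep T (i, (reverseIf (decide (Odd i.val ∨ i = Fin.last (2 * m)))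
      (T i).tile.right k : {v : Vtx // (T i).HasVertex v}).1) =
    glueRep T (i + 1, (reverseIf (decide (Odd (i + 1).val))
      (T (i + 1)).tile.left k : {v : Vtx // (T (i + 1)).HasVertex v}).1)
  rw [hf]
  generalize decide (Odd i.val ∨ i = Fin.last (2 * m)) = f
  have e1 : glueRep T (i, wr) = glueRep T (i + 1, wl) := by rw [glueRep_wr, glueRep_wl]
  have e2 : glueRep T (i, (T i).frame.rightTop) = glueRep T (i + 1, bl) := by
    rw [glueRep_rightTop, glueRep_bl]
  cases f <;> fin_cases k
  · exact e1
  · exact e2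
  · exact e2
  · exact e1

/-- The vertex of the twisted cyclization given by the vertex `v` of tile `i`. -/
def vertexOf (i : Fin (2 * m + 1)) (v : Vtx) (h : (T i).HasVertex v) :
    (twistedCyclization T).V :=
  Quot.mk (Glue (invertedTile T)) ⟨i, (⟨v, h⟩ : {v : Vtx // (T i).HasVertex v})⟩

theorem exists_vertexOf (x : (twistedCyclization T).V) : ∃ i v h, x = vertexOf T i v h := by
  induction x using Quot.ind with
  | mk a =>
    obtain ⟨i, v, h⟩ := a
    exact ⟨i, v, h, rfl⟩

/-- The representative of a vertex of the twisted cyclization. -/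
def rep : (twistedCyclization T).V → Fin (2 * m + 1) × Vtx :=
  Quot.lift (r := Glue (invertedTile T))
    (fun x => glueRep T (x.1, (x.2 : {v : Vtx // (T x.1).HasVertex v}).1)) (glueRep_respects T)

theorem rep_vertexOf (i : Fin (2 * m + 1)) (v : Vtx) (h : (T i).HasVertex v) :
    rep T (vertexOf T i v h) = glueRep T (i, v) := rfl

theorem vertexOf_wr_and_rightTop (i : Fin (2 * m + 1)) :
    vertexOf T i wr (T i).hasVertex_wr = vertexOf T (i + 1) wl (T (i + 1)).hasVertex_wl ∧
    vertexOf T i (T i).frame.rightTop (T i).hasVertex_rightTop =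
      vertexOf T (i + 1) bl (T (i + 1)).hasVertex_bl := by
  have hf := odd_add_one_iff i
  have key : ∀ k : Fin 2,
      Quot.mk (Glue (invertedTile T)) ⟨i, reverseIf (decide (Odd i.val ∨ i = Fin.last (2 * m)))
        (T i).tile.right k⟩ =
      Quot.mk (Glue (invertedTile T)) ⟨i + 1, reverseIf (decide (Odd (i + 1).val))
        (T (i + 1)).tile.left k⟩ := fun k => Quot.sound (Glue.mk i k)
  rw [hf] at key
  generalize decide (Odd i.val ∨ i = Fin.last (2 * m)) = f at key
  cases f
  · exact ⟨key 0, key 1⟩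
  · exact ⟨key 1, key 0⟩

theorem exists_vertexOf_glueRep (i : Fin (2 * m + 1)) (v : Vtx) (h : (T i).HasVertex v) :
    ∃ h', vertexOf T i v h = vertexOf T (glueRep T (i, v)).1 (glueRep T (i, v)).2 h' := by
  rcases glueRep_cases T i v with ⟨rfl, h'⟩ | ⟨rfl, h'⟩ | ⟨_, _, h'⟩ <;> rw [h']
  · exact ⟨_, (vertexOf_wr_and_rightTop T i).1⟩
  · exact ⟨_, (vertexOf_wr_and_rightTop T i).2⟩
  · exact ⟨h, rfl⟩

/-- A vertex is the class of its own representative, hence determined by it. -/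
theorem rep_injective : Function.Injective (rep T) := by
  intro x y hxy
  obtain ⟨i, v, h, rfl⟩ := exists_vertexOf T x
  obtain ⟨j, w, k, rfl⟩ := exists_vertexOf T y
  rw [rep_vertexOf, rep_vertexOf] at hxy
  obtain ⟨h', e⟩ := exists_vertexOf_glueRep T i v h
  obtain ⟨k', e'⟩ := exists_vertexOf_glueRep T j w k
  rw [e, e']
  revert h' k'
  rw [hxy]
  intros; rfl

theorem rep_cases (x : (twistedCyclization T).V) :
    (∃ i, rep T x = (i, wl)) ∨ (∃ i, rep T x = (i, bl)) ∨
    ∃ i v h, x = vertexOf T i v h ∧ rep T x = (i, v) ∧ v ≠ wl ∧ v ≠ bl ∧ v ≠ wr ∧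
      v ≠ (T i).frame.rightTop := by
  obtain ⟨i, v, h, rfl⟩ := exists_vertexOf T x
  rw [rep_vertexOf]
  rcases glueRep_cases T i v with ⟨rfl, h'⟩ | ⟨rfl, h'⟩ | ⟨h1, h2, h'⟩ <;> rw [h']
  · exact Or.inl ⟨_, rfl⟩
  · exact Or.inr (Or.inl ⟨_, rfl⟩)
  · by_cases h3 : v = wl
    · exact Or.inl ⟨i, by rw [h3]⟩
    by_cases h4 : v = bl
    · exact Or.inr (Or.inl ⟨i, by rw [h4]⟩)
    exact Or.inr (Or.inr ⟨i, v, h, rfl, rfl, h3, h4, h1, h2⟩)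

/-! ### Adjacency -/

/-- Adjacency of representatives. -/
def RepAdj (p q : Fin (2 * m + 1) × Vtx) : Prop :=
  ∃ j a b, (T j).TAdj a b ∧ glueRep T (j, a) = p ∧ glueRep T (j, b) = q

theorem RepAdj.of_tAdj {j : Fin (2 * m + 1)} {a b : Vtx} (h : (T j).TAdj a b) :
    RepAdj T (glueRep T (j, a)) (glueRep T (j, b)) := ⟨j, a, b, h, rfl, rfl⟩

theorem RepAdj.symm {p q : Fin (2 * m + 1) × Vtx} (h : RepAdj T p q) : RepAdj T q p := by
  obtain ⟨j, a, b, h, h1, h2⟩ := h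
  exact ⟨j, b, a, h.symm, h2, h1⟩

theorem adj_iff_repAdj (x y : (twistedCyclization T).V) :
    (twistedCyclization T).Adj x y ↔ RepAdj T (rep T x) (rep T y) := by
  constructor
  · rintro ⟨⟨j, k⟩, h | h⟩
    · have h1 := congrArg (fun z => rep T z.1) h
      have h2 := congrArg (fun z => rep T z.2) h
      exact ⟨j, _, _, Or.inl (List.get_mem (T j).edges k), h1, h2⟩
    · have h1 := congrArg (fun z => rep T z.1) h
      have h2 := congrArg (fun z => rep T z.2) h
      exact ⟨j, _, _, Or.inr (List.get_mem (T j).edges k), h2, h1⟩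
  · rintro ⟨j, a, b, h | h, h1, h2⟩
    all_goals
      obtain ⟨k, hk⟩ := List.get_of_mem h
      have e1 := congrArg Prod.fst hk
      have e2 := congrArg Prod.snd hk
      dsimp only at e1 e2
    · refine ⟨⟨j, k⟩, Or.inl (Prod.ext (rep_injective T ?_) (rep_injective T ?_))⟩
      · rw [← h1, ← e1]; rfl
      · rw [← h2, ← e2]; rfl
    · refine ⟨⟨j, k⟩, Or.inr (Prod.ext (rep_injective T ?_) (rep_injective T ?_))⟩
      · rw [← h2, ← e1]; rfl
      · rw [← h1, ← e2]; rfl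

theorem RepAdj.eq_of_wl {i : Fin (2 * m + 1)} {q : Fin (2 * m + 1) × Vtx}
    (h : RepAdj T (i + 1, wl) q) : q = (i + 1, tl) ∨ q = (i, br) := by
  obtain ⟨j, a, b, h, h1, rfl⟩ := h
  rcases eq_of_glueRep_eq_wl T h1 with ⟨rfl, rfl⟩ | ⟨h2, rfl⟩
  · rw [(T (i + 1)).eq_tl_of_tAdj_wl b h, glueRep_tl]; exact Or.inl rfl
  · obtain rfl := add_right_cancel h2
    rw [(T j).eq_br_of_tAdj_wr b h, glueRep_br]; exact Or.inr rfl

/-! ### Degrees -/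

/-- The number of edge ends in tile `j` at the vertex with representative `p`. -/
def glueCount (j : Fin (2 * m + 1)) (p : Fin (2 * m + 1) × Vtx) : ℕ :=
  ((T j).edges.map fun e =>
    (if glueRep T (j, e.1) = p then 1 else 0) + if glueRep T (j, e.2) = p then 1 else 0).sum

theorem card_sigma_fin_subtype {n : ℕ} {l : Fin n → ℕ} (P : (Σ j, Fin (l j)) → Prop)
    [DecidablePred P] :
    Nat.card {e // P e} = ∑ j, ∑ k : Fin (l j), if P ⟨j, k⟩ then 1 else 0 := by
  rw [Nat.card_eq_fintype_card, Fintype.card_subtype, Finset.card_filter, Fintype.sum_sigma]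

theorem degree_eq (x : (twistedCyclization T).V) :
    (twistedCyclization T).degree x = ∑ j, glueCount T j (rep T x) := by
  have h1 : Nat.card {e // ((twistedCyclization T).ends e).1 = x} =
      Nat.card {e : Σ j, Fin (T j).edges.length //
        glueRep T (e.1, ((T e.1).edges.get e.2).1) = rep T x} :=
    Nat.card_congr (Equiv.subtypeEquivRight fun e => (rep_injective T).eq_iff.symm)
  have h2 : Nat.card {e // ((twistedCyclization T).ends e).2 = x} =
      Nat.card {e : Σ j, Fin (T j).edges.length //
        glueRep T (e.1, ((T e.1).edges.get e.2).2) = rep T x} :=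
    Nat.card_congr (Equiv.subtypeEquivRight fun e => (rep_injective T).eq_iff.symm)
  rw [MGraph.degree, h1, h2, card_sigma_fin_subtype, card_sigma_fin_subtype,
    ← Finset.sum_add_distrib]
  refine Finset.sum_congr rfl fun j _ => ?_
  rw [← Finset.sum_add_distrib, glueCount, ← Fin.sum_univ_fun_getElem]
  rfl

theorem endCount_le_glueCount (j : Fin (2 * m + 1)) (v : Vtx) :
    endCount (T j).edges v ≤ glueCount T j (glueRep T (j, v)) := by
  refine List.sum_le_sum fun e _ => Nat.add_le_add ?_ ?_
  all_goals
    split_ifs with h1 h2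
    · exact le_rfl
    · exact absurd (by rw [h1]) h2
    · exact Nat.zero_le _
    · exact le_rfl

theorem glueCount_eq_endCount (j : Fin (2 * m + 1)) (v : Vtx) (p : Fin (2 * m + 1) × Vtx)
    (h : ∀ u, glueRep T (j, u) = p ↔ u = v) : glueCount T j p = endCount (T j).edges v := by
  simp only [glueCount, endCount, h]

theorem glueCount_eq_zero (j : Fin (2 * m + 1)) (p : Fin (2 * m + 1) × Vtx)
    (h : ∀ u, glueRep T (j, u) ≠ p) : glueCount T j p = 0 := by
  simp [glueCount, h]

theorem ne_add_one (hm : 1 ≤ m) (i : Fin (2 * m + 1)) : i ≠ i + 1 := by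
  have : NeZero m := ⟨by omega⟩
  intro h
  have h1 : (1 : Fin (2 * m + 1)) = 0 := by simpa using h.symm
  have h2 := congrArg Fin.val h1
  rw [Fin.val_one', Fin.val_zero, Nat.mod_eq_of_lt (by omega)] at h2
  omega

/-- Just two tiles meet at this vertex, and each has a single edge end there; `1 ≤ m` makes them
distinct. -/
theorem degree_of_wl (hm : 1 ≤ m) (i : Fin (2 * m + 1)) (x : (twistedCyclization T).V)
    (hx : rep T x = (i + 1, wl)) : (twistedCyclization T).degree x = 2 := by
  rw [degree_eq, hx, Finset.sum_eq_add i (i + 1) (ne_add_one hm i)]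
  · rw [glueCount_eq_endCount T i wr, glueCount_eq_endCount T (i + 1) wl,
      (T i).endCount_wr, (T (i + 1)).endCount_wl]
    · intro u
      constructor
      · intro h
        rcases eq_of_glueRep_eq_wl T h with h' | h'
        · exact h'.2
        · exact absurd (add_right_cancel h'.1).symm (ne_add_one hm i)
      · rintro rfl; exact glueRep_wl T _
    · intro u
      constructor
      · intro h
        rcases eq_of_glueRep_eq_wl T h with h' | h'
        · exact absurd h'.1 (ne_add_one hm i)
        · exact h'.2
      · rintro rfl; exact glueRep_wr T _
  · intro j _ hj
    refine glueCount_eq_zero T j _ fun u h => ?_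
    rcases eq_of_glueRep_eq_wl T h with h' | h'
    · exact hj.2 h'.1
    · exact hj.1 (add_right_cancel h'.1)
  · simp
  · simp

/-- A shared vertex gets at least two edge ends from each of its two tiles; any other vertex has at
least three in its own tile. -/
theorem degree_of_ne_wl (hm : 1 ≤ m) (x : (twistedCyclization T).V)
    (hx : (rep T x).2 ≠ wl) : (twistedCyclization T).degree x ≠ 2 := by
  suffices h : 3 ≤ (twistedCyclization T).degree x by omega
  rw [degree_eq]
  rcases rep_cases T x with ⟨i, h⟩ | ⟨i, h⟩ | ⟨i, v, hv, rfl, h, h1, h2, h3, h4⟩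
  · exact absurd (by rw [h]) hx
  · obtain ⟨j, rfl⟩ : ∃ j, i = j + 1 := ⟨i - 1, (sub_add_cancel i 1).symm⟩
    rw [h]
    have e1 := endCount_le_glueCount T j (T j).frame.rightTop
    have e2 := endCount_le_glueCount T (j + 1) bl
    rw [glueRep_rightTop] at e1
    rw [glueRep_bl] at e2
    have e3 := (T j).two_le_endCount_rightTop
    have e4 := (T (j + 1)).two_le_endCount_bl
    have e5 := Finset.sum_le_sum_of_subset (f := fun k => glueCount T k (j + 1, bl))
      (Finset.subset_univ {j, j + 1})
    rw [Finset.sum_pair (ne_add_one hm j)] at e5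
    omega
  · refine ((T i).three_le_endCount v hv h2 h1 h3 h4).trans
      ((endCount_le_glueCount T i v).trans ?_)
    exact Finset.single_le_sum (f := fun k => glueCount T k (glueRep T (i, v)))
      (fun _ _ => Nat.zero_le _) (Finset.mem_univ i)

theorem degree_eq_two_iff (hm : 1 ≤ m) (x : (twistedCyclization T).V) :
    (twistedCyclization T).degree x = 2 ↔ (rep T x).2 = wl := by
  constructor
  · intro h
    by_contra h'
    exact degree_of_ne_wl T hm x h' h
  · intro h
    refine degree_of_wl T hm ((rep T x).1 - 1) x ?_
    rw [sub_add_cancel, ← h]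

/-! ### Adjacency after suppression -/

theorem RepAdj.of_thread (hm : 1 ≤ m) {x y : (twistedCyclization T).V}
    (h : (twistedCyclization T).Thread x y) :
    RepAdj T (rep T x) (rep T y) ∨
      ∃ i, RepAdj T (i + 1, wl) (rep T x) ∧ RepAdj T (i + 1, wl) (rep T y) := by
  induction h with
  | edge h => exact Or.inl ((adj_iff_repAdj T _ _).mp h)
  | @step w v _ hw h ih =>
    have hw' : rep T w = ((rep T w).1 - 1 + 1, wl) := by
      rw [sub_add_cancel, ← (degree_eq_two_iff T hm w).mp hw]
    have h' := (adj_iff_repAdj T _ _).mp h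
    rw [hw'] at h' ih
    rcases ih with ih | ⟨i, _, ih⟩
    · exact Or.inr ⟨_, ih.symm, h'⟩
    -- Degree-two vertices are adjacent only to vertices `tl` and `br`, never to each other, so a
    -- thread cannot pass two in a row.
    · rcases ih.eq_of_wl T with ih | ih <;>
        simpa using congrArg Prod.snd ih

/-- Adjacency of representatives in the suppressed graph. -/
theorem largeGraph_adj (hm : 1 ≤ m)
    {x y : {v : (twistedCyclization T).V // (twistedCyclization T).degree v ≠ 2}}
    (h : (largeGraph T).Adj x y) :
    RepAdj T (rep T x.1) (rep T y.1) ∨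
      ∃ i, (rep T x.1 = (i + 1, tl) ∧ rep T y.1 = (i, br)) ∨
        (rep T x.1 = (i, br) ∧ rep T y.1 = (i + 1, tl)) := by
  have aux : ∀ {x y : {v : (twistedCyclization T).V // (twistedCyclization T).degree v ≠ 2}},
      x ≠ y → (twistedCyclization T).Thread x.1 y.1 → RepAdj T (rep T x.1) (rep T y.1) ∨
      ∃ i, (rep T x.1 = (i + 1, tl) ∧ rep T y.1 = (i, br)) ∨
        (rep T x.1 = (i, br) ∧ rep T y.1 = (i + 1, tl)) := by
    intro x y hne h
    have hne' : rep T x.1 ≠ rep T y.1 := fun e => hne (Subtype.ext (rep_injective T e))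
    rcases RepAdj.of_thread T hm h with h | ⟨i, h1, h2⟩
    · exact Or.inl h
    · rcases h1.eq_of_wl T with h1 | h1 <;> rcases h2.eq_of_wl T with h2 | h2
      · exact absurd (h1.trans h2.symm) hne'
      · exact Or.inr ⟨i, Or.inl ⟨h1, h2⟩⟩
      · exact Or.inr ⟨i, Or.inr ⟨h1, h2⟩⟩
      · exact absurd (h1.trans h2.symm) hne'
  obtain ⟨hne, h | h⟩ := h
  · exact aux hne h
  · rcases aux hne.symm h with h | ⟨i, h | h⟩
    · exact Or.inl h.symm
    · exact Or.inr ⟨i, Or.inr h.symm⟩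
    · exact Or.inr ⟨i, Or.inl h.symm⟩

/-- For the upper bound, edges surviving from the cyclization suffice; those created by suppression
are ignored. -/
theorem isDominating_of_repAdj
    (D : Finset {v : (twistedCyclization T).V // (twistedCyclization T).degree v ≠ 2})
    (h : ∀ x : {v : (twistedCyclization T).V // (twistedCyclization T).degree v ≠ 2},
      ∃ u ∈ D, u = x ∨ RepAdj T (rep T u.1) (rep T x.1)) :
    IsDominating (largeGraph T) D := by
  intro x
  obtain ⟨u, hu, h⟩ := h x
  refine ⟨u, hu, ?_⟩
  by_cases hux : u = x
  · exact Or.inl hux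
  · refine Or.inr ⟨hux, Or.inl (MGraph.Thread.edge ?_)⟩
    exact (adj_iff_repAdj T _ _).mpr (h.resolve_left hux)

end Model

/-! ### The lower bound -/

section Discharging

/-- The discharging argument. Tile `i` contains `a i` chosen vertices apart from the two which it
shares with its neighbours; `b i` says that the vertex shared with the previous tile is chosen, and
`t i` and `r i` that its vertices `tl` and `br` are. A tile without chosen vertices receives `1/3`
from each of its neighbours, a tile in which only one shared vertex is chosen receives
`1/6` from the neighbour at the other one. -/
theorem discharging {n : ℕ} [NeZero n] (a : Fin n → ℕ) (b t r : Fin n → Prop)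
    [DecidablePred b]
    (ht : ∀ i, t i → 1 ≤ a i) (hr : ∀ i, r i → 1 ≤ a i)
    (zero_t : ∀ i, a i = 0 → ¬ b i → ¬ b (i + 1) → t (i + 1))
    (zero_r : ∀ i, a (i + 1) = 0 → ¬ b (i + 1) → ¬ b (i + 1 + 1) → r i)
    (half_bl : ∀ i, a i = 0 → b i → ¬ b (i + 1) → 1 ≤ a (i + 1))
    (half_rightTop : ∀ i, a (i + 1) = 0 → ¬ b (i + 1) → b (i + 1 + 1) → 1 ≤ a i)
    (one_t : ∀ i, a i = 1 → t i → ¬ b i → ¬ b (i + 1) → t (i + 1))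
    (one_r : ∀ i, a (i + 1) = 1 → r (i + 1) → ¬ b (i + 1) → ¬ b (i + 1 + 1) → r i) :
    2 * n ≤ 3 * ∑ i, (a i + if b i then 1 else 0) := by
  set β : Fin n → ℕ := fun i => if b i then 1 else 0 with hβ
  -- Charges are in units of 1/6. `R i` is what tile `i` receives from tile `i + 1`, and `L i` what
  -- it receives from tile `i - 1`; nothing is passed across a chosen shared vertex.
  set R : Fin n → ℕ := fun i =>
    if a i = 0 ∧ ¬ b (i + 1) then (if b i then 1 else 2) else 0 with hR
  set L : Fin n → ℕ := fun i =>
    if a i = 0 ∧ ¬ b i then (if b (i + 1) then 1 else 2) else 0 with hL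
  have shift : ∀ f : Fin n → ℕ, ∑ i, f (i + 1) = ∑ i, f i := fun f =>
    Equiv.sum_comp (Equiv.addRight (1 : Fin n)) f
  -- The balance of tile `i + 1`: it needs 4, that is 2/3, and gives away `R i` and `L (i + 1 + 1)`.
  -- Centring at `i + 1` avoids subtraction in the indices.
  have key : ∀ i, 4 + R i + L (i + 1 + 1) ≤
      6 * a (i + 1) + 3 * β (i + 1) + 3 * β (i + 1 + 1) + R (i + 1) + L (i + 1) := by
    intro i
    have ht1 := ht (i + 1)
    have ht2 := ht (i + 1 + 1)
    have hr1 := hr (i + 1)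
    have hr0 := hr i
    have z1 := zero_t i
    have z2 := zero_t (i + 1)
    have z3 := zero_r i
    have z4 := zero_r (i + 1)
    have p1 := half_bl i
    have p2 := half_bl (i + 1)
    have q1 := half_rightTop i
    have q2 := half_rightTop (i + 1)
    have o1 := one_t (i + 1)
    have o2 := one_r i
    simp only [hβ, hR, hL]
    clear_value β R L
    clear hβ hR hL shift ht hr zero_t zero_r half_bl half_rightTop one_t one_r
    generalize a (i + 1 + 1) = a2 at *
    generalize a (i + 1) = a1 at *
    generalize a i = a0 at *
    -- The tight case is one private and no shared chosen vertex: 6 units, of which 2 may be given.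
    -- Giving 2 to one side forces that private vertex to be `tl` or `br`; then `one_t` or `one_r`
    -- shows that the other side has a private vertex and receives nothing.
    by_cases b0 : b i <;> by_cases b1 : b (i + 1) <;> by_cases b2 : b (i + 1 + 1) <;>
      by_cases b3 : b (i + 1 + 1 + 1) <;>
      simp only [b0, b1, b2, b3, not_true_eq_false, not_false_eq_true, and_true, and_false,
        if_true, if_false, forall_const, false_implies] at * <;>
      grind
  -- Summed around the cycle, the transfers `R` and `L` cancel.
  have h := Finset.sum_le_sum fun i (_ : i ∈ Finset.univ) => key i
  simp only [Finset.sum_add_distrib, ← Finset.mul_sum] at h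
  rw [shift fun i => L (i + 1), shift L, shift R, shift fun i => β (i + 1), shift β, shift a] at h
  simp only [Finset.sum_const, Finset.card_univ, Fintype.card_fin, smul_eq_mul] at h
  rw [Finset.sum_add_distrib]
  change 2 * n ≤ 3 * (∑ i, a i + ∑ i, β i)
  omega

end Discharging

/-! ### From dominating sets to the hypotheses of the discharging -/

section LowerBound

variable {m : ℕ} (T : Fin (2 * m + 1) → TileName)

/-- A set of representatives dominates the graph given by `T`. -/
structure RepDominating (F : Finset (Fin (2 * m + 1) × Vtx)) : Prop where
  wl_notMem : ∀ i, (i, wl) ∉ F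
  dominates : ∀ i v, (T i).HasVertex v → (glueRep T (i, v)).2 ≠ wl →
    glueRep T (i, v) ∈ F ∨ ∃ q ∈ F, RepAdj T (glueRep T (i, v)) q ∨
      ∃ j, (q = (j + 1, tl) ∧ glueRep T (i, v) = (j, br)) ∨
        (q = (j, br) ∧ glueRep T (i, v) = (j + 1, tl))

open Classical in
theorem RepDominating.of_isDominating (hm : 1 ≤ m)
    {D : Finset {v : (twistedCyclization T).V // (twistedCyclization T).degree v ≠ 2}}
    (hD : IsDominating (largeGraph T) D) :
    RepDominating T (D.image fun x => rep T x.1) where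
  wl_notMem := by
    intro i h
    obtain ⟨x, _, hx⟩ := Finset.mem_image.mp h
    exact x.2 ((degree_eq_two_iff T hm _).mpr (by rw [hx]))
  dominates := by
    intro i v hv hne
    obtain ⟨u, hu, h⟩ := hD ⟨vertexOf T i v hv, degree_of_ne_wl T hm _ hne⟩
    rcases h with rfl | h
    · exact Or.inl (Finset.mem_image.mpr ⟨_, hu, rfl⟩)
    · refine Or.inr ⟨_, Finset.mem_image_of_mem _ hu, ?_⟩
      rcases largeGraph_adj T hm h with h | h
      · exact Or.inl h.symm
      · exact Or.inr h

variable {T}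

namespace RepDominating

variable {F : Finset (Fin (2 * m + 1) × Vtx)} (hF : RepDominating T F)

/-- A chosen vertex of tile `i` is one of the shared vertices or one that only lies in tile `i`. -/
theorem mem_cases (hF : RepDominating T F) {i : Fin (2 * m + 1)} {v : Vtx} (h : glueRep T (i, v) ∈ F) :
    (v = bl ∧ (i, bl) ∈ F) ∨ (v = (T i).frame.rightTop ∧ (i + 1, bl) ∈ F) ∨
      (v ≠ bl ∧ (i, v) ∈ F) := by
  rcases glueRep_cases T i v with ⟨rfl, h'⟩ | ⟨hv, h'⟩ | ⟨_, _, h'⟩ <;> rw [h'] at h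
  · exact absurd h (hF.wl_notMem _)
  · exact Or.inr (Or.inl ⟨hv, h⟩)
  · by_cases hv : v = bl
    · subst hv; exact Or.inl ⟨rfl, h⟩
    · exact Or.inr (Or.inr ⟨hv, h⟩)

/-- As `tl` lies on no wall, its only neighbour outside its tile is `br` of the previous one, across
a suppressed vertex. -/
theorem dominates_tl (hF : RepDominating T F) (i : Fin (2 * m + 1)) :
    (i, br) ∈ F ∨ ∃ v, (v = tl ∨ (T (i + 1)).TAdj tl v) ∧ glueRep T (i + 1, v) ∈ F := by
  have h := hF.dominates (i + 1) tl (T (i + 1)).tAdj_tl_wl.hasVertex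
    (by simp [glueRep_tl])
  rw [glueRep_tl] at h
  rcases h with h | ⟨q, hq, h | ⟨j, ⟨_, h⟩ | ⟨rfl, h⟩⟩⟩
  · exact Or.inr ⟨tl, Or.inl rfl, by rwa [glueRep_tl]⟩
  · obtain ⟨j, a, b, h, h1, rfl⟩ := h
    obtain ⟨rfl, rfl⟩ := eq_of_glueRep_eq T h1 (by decide) (by decide)
    exact Or.inr ⟨b, Or.inr h, hq⟩
  · exact absurd (congrArg Prod.snd h) (by simp)
  · obtain rfl := add_right_cancel (congrArg Prod.fst h)
    exact Or.inl hq

theorem dominates_br (hF : RepDominating T F) (i : Fin (2 * m + 1)) :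
    (i + 1, tl) ∈ F ∨ ∃ v, (v = br ∨ (T i).TAdj br v) ∧ glueRep T (i, v) ∈ F := by
  have h := hF.dominates i br (T i).tAdj_br_wr.hasVertex (by simp [glueRep_br])
  rw [glueRep_br] at h
  rcases h with h | ⟨q, hq, h | ⟨j, ⟨rfl, h⟩ | ⟨_, h⟩⟩⟩
  · exact Or.inr ⟨br, Or.inl rfl, by rwa [glueRep_br]⟩
  · obtain ⟨j, a, b, h, h1, rfl⟩ := h
    obtain ⟨rfl, rfl⟩ := eq_of_glueRep_eq T h1 (by decide) (by decide)
    exact Or.inr ⟨b, Or.inr h, hq⟩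
  · obtain rfl : i = j := congrArg Prod.fst h
    exact Or.inl hq
  · exact absurd (congrArg Prod.snd h) (by simp)

theorem dominates_bl (hF : RepDominating T F) (i : Fin (2 * m + 1)) :
    (i + 1, bl) ∈ F ∨ (∃ v, (T i).TAdj (T i).frame.rightTop v ∧ glueRep T (i, v) ∈ F) ∨
      ∃ v, (T (i + 1)).TAdj bl v ∧ glueRep T (i + 1, v) ∈ F := by
  have h := hF.dominates (i + 1) bl (T (i + 1)).hasVertex_bl (by simp [glueRep_bl])
  rw [glueRep_bl] at h
  rcases h with h | ⟨q, hq, h | ⟨j, ⟨_, h⟩ | ⟨_, h⟩⟩⟩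
  · exact Or.inl h
  · obtain ⟨j, a, b, h, h1, rfl⟩ := h
    rcases eq_of_glueRep_eq_bl T h1 with ⟨rfl, rfl⟩ | ⟨h2, rfl⟩
    · exact Or.inr (Or.inr ⟨b, h, hq⟩)
    · obtain rfl := add_right_cancel h2
      exact Or.inr (Or.inl ⟨b, h, hq⟩)
  · exact absurd (congrArg Prod.snd h) (by simp)
  · exact absurd (congrArg Prod.snd h) (by simp)

open Classical in
theorem two_mul_le (hF : RepDominating T F) : 2 * (2 * m + 1) ≤ 3 * F.card := by
  -- The chosen private vertices of tile `i`: a shared vertex is always represented by `bl` of the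
  -- later tile.
  set I : Fin (2 * m + 1) → Finset (Fin (2 * m + 1) × Vtx) :=
    fun i => F.filter fun p => p.1 = i ∧ p.2 ≠ bl with hI
  have mem_I : ∀ {i v}, (i, v) ∈ F → v ≠ bl → (i, v) ∈ I i := fun h1 h2 =>
    Finset.mem_filter.mpr ⟨h1, rfl, h2⟩
  have pos : ∀ {i v}, (i, v) ∈ F → v ≠ bl → 1 ≤ (I i).card := fun h1 h2 =>
    Finset.card_pos.mpr ⟨_, mem_I h1 h2⟩
  have zero : ∀ {i v}, (I i).card = 0 → v ≠ bl → (i, v) ∉ F := fun h0 h2 h1 => by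
    have := pos h1 h2
    omega
  have one : ∀ {i u v}, (I i).card = 1 → (i, u) ∈ F → u ≠ bl → (i, v) ∈ F → v ≠ bl → u = v :=
    fun h hu hu' hv hv' => congrArg Prod.snd
      (Finset.card_le_one.mp h.le _ (mem_I hu hu') _ (mem_I hv hv'))
  have card_F : F.card = ∑ i, ((I i).card + if (i, bl) ∈ F then 1 else 0) := by
    rw [Finset.card_eq_sum_card_fiberwise (f := Prod.fst) (t := Finset.univ)
      fun _ _ => Finset.mem_coe.mpr (Finset.mem_univ _)]
    refine Finset.sum_congr rfl fun i _ => ?_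
    rw [← Finset.card_filter_add_card_filter_not (s := F.filter fun p => p.1 = i)
      (fun p => p.2 ≠ bl), Finset.filter_filter, Finset.filter_filter]
    congr 1
    split_ifs with h
    · refine Finset.card_eq_one.mpr ⟨(i, bl), ?_⟩
      ext ⟨j, v⟩
      simp only [Finset.mem_filter, Finset.mem_singleton, Prod.mk.injEq, not_not]
      exact ⟨fun h => h.2, fun h' => ⟨by rwa [h'.1, h'.2], h'⟩⟩
    · refine Finset.card_eq_zero.mpr (Finset.filter_eq_empty_iff.mpr ?_)
      rintro ⟨j, v⟩ hp ⟨rfl, h'⟩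
      rw [not_not] at h'
      subst h'
      exact h hp
  rw [card_F]
  refine discharging (fun i => (I i).card) (fun i => (i, bl) ∈ F) (fun i => (i, tl) ∈ F)
    (fun i => (i, br) ∈ F) (fun i h => pos h (by decide)) (fun i h => pos h (by decide))
    ?_ ?_ ?_ ?_ ?_ ?_
  -- With no chosen vertex in tile `i`, its `br` can only be dominated by the next `tl`.
  · intro i h0 h1 h2
    refine (hF.dominates_br i).resolve_right ?_
    rintro ⟨v, _, hv⟩
    rcases hF.mem_cases hv with ⟨_, h⟩ | ⟨_, h⟩ | ⟨h, h'⟩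
    · exact h1 h
    · exact h2 h
    · exact zero h0 h h'
  · intro i h0 h1 h2
    refine (hF.dominates_tl i).resolve_right ?_
    rintro ⟨v, _, hv⟩
    rcases hF.mem_cases hv with ⟨_, h⟩ | ⟨_, h⟩ | ⟨h, h'⟩
    · exact h1 h
    · exact h2 h
    · exact zero h0 h h'
  -- The unchosen shared vertex is not adjacent to the chosen one at the other end of tile `i`, so a
  -- private vertex of tile `i + 1` must dominate it.
  · intro i h0 h1 h2
    rcases hF.dominates_bl i with h | ⟨v, hv, h⟩ | ⟨v, hv, h⟩
    · exact absurd h h2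
    · rcases hF.mem_cases h with ⟨rfl, h⟩ | ⟨_, h⟩ | ⟨h, h'⟩
      · exact absurd hv.symm (T i).not_tAdj_bl_rightTop
      · exact absurd h h2
      · exact absurd h' (zero h0 h)
    · rcases hF.mem_cases h with ⟨_, h⟩ | ⟨rfl, h⟩ | ⟨h, h'⟩
      · exact absurd h h2
      · exact absurd hv (T (i + 1)).not_tAdj_bl_rightTop
      · exact pos h' h
  · intro i h0 h1 h2
    rcases hF.dominates_bl i with h | ⟨v, hv, h⟩ | ⟨v, hv, h⟩
    · exact absurd h h1
    · rcases hF.mem_cases h with ⟨rfl, h⟩ | ⟨_, h⟩ | ⟨h, h'⟩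
      · exact absurd hv.symm (T i).not_tAdj_bl_rightTop
      · exact absurd h h1
      · exact pos h' h
    · rcases hF.mem_cases h with ⟨_, h⟩ | ⟨rfl, h⟩ | ⟨h, h'⟩
      · exact absurd h h1
      · exact absurd hv (T (i + 1)).not_tAdj_bl_rightTop
      · exact absurd h' (zero h0 h)
  -- Here `tl` is the only chosen vertex of tile `i` and is not adjacent to `br`, so `br` is
  -- dominated from the next tile.
  · intro i h0 ht h1 h2
    refine (hF.dominates_br i).resolve_right ?_
    rintro ⟨v, hv, hv'⟩
    rcases hF.mem_cases hv' with ⟨_, h⟩ | ⟨_, h⟩ | ⟨h, h'⟩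
    · exact h1 h
    · exact h2 h
    · obtain rfl := one h0 ht (by decide) h' h
      exact hv.elim (by decide) fun hv => (T i).not_tAdj_tl_br hv.symm
  · intro i h0 hr h1 h2
    refine (hF.dominates_tl i).resolve_right ?_
    rintro ⟨v, hv, hv'⟩
    rcases hF.mem_cases hv' with ⟨_, h⟩ | ⟨_, h⟩ | ⟨h, h'⟩
    · exact h1 h
    · exact h2 h
    · obtain rfl := one h0 hr (by decide) h' h
      exact hv.elim (by decide) fun hv => (T (i + 1)).not_tAdj_tl_br hv

end RepDominating

theorem finite_largeGraph_vertices (T : Fin (2 * m + 1) → TileName) :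
    Finite {v : (twistedCyclization T).V // (twistedCyclization T).degree v ≠ 2} := by
  have := Vtx.finite
  have : Finite (twistedCyclization T).V := Finite.of_injective _ (rep_injective T)
  exact Subtype.finite

theorem two_mul_le_dominationNumber (hm : 1 ≤ m) (T : Fin (2 * m + 1) → TileName) :
    2 * (2 * m + 1) ≤ 3 * dominationNumber (largeGraph T) := by
  classical
  have := finite_largeGraph_vertices T
  have := Fintype.ofFinite
    {v : (twistedCyclization T).V // (twistedCyclization T).degree v ≠ 2}
  -- The set of all vertices shows that the infimum is attained; for an empty set `sInf` would be 0.
  obtain ⟨D, hD, hcard⟩ := Nat.sInf_mem (s := {k | ∃ D : Finset _,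
      IsDominating (largeGraph T) D ∧ D.card = k})
    ⟨_, Finset.univ, fun v => ⟨v, Finset.mem_univ _, Or.inl rfl⟩, rfl⟩
  have h := (RepDominating.of_isDominating T hm hD).two_mul_le
  have h' := Finset.card_image_le (s := D) (f := fun x => rep T x.1)
  unfold dominationNumber
  omega

/-- Every tile contributes one letter `L` to the signature. -/
theorem numL_eq (T : Fin (2 * m + 1) → TileName) : numL T = 2 * m + 1 := by
  have h : ∀ S : TileName, S.signature.count Letter.L = 1 :=
    TileName.forall_of_lists (by decide)
  simp [numL, signature, List.count_flatten, List.map_ofFn, Function.comp_def, h, add_comm]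

end LowerBound

/-! ### The sharp example -/

section Sharp

variable (k : ℕ)

theorem sharpSequence_hasVertex_lt {i : Fin (2 * (3 * k + 1) + 1)} (h : i.val % 3 = 2) :
    (sharpSequence k i).HasVertex lt := by
  rw [sharpSequence, if_pos h]
  exact TileName.TAdj.hasVertex (v := tl) (by decide)

theorem sharpSequence_hasVertex_tr (i : Fin (2 * (3 * k + 1) + 1)) :
    (sharpSequence k i).HasVertex tr := by
  unfold sharpSequence
  split_ifs
  · exact TileName.TAdj.hasVertex (v := tl) (by decide)
  · exact TileName.TAdj.hasVertex (v := tl) (by decide)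

theorem mem_of_hasVertex_DDL (v : Vtx) (h : TileName.HasVertex ⟨.paths .D .D, .L⟩ v)
    (hwl : v ≠ wl) (hwr : v ≠ wr) : v = tl ∨ v = tr ∨ v = bl ∨ v = br := by
  obtain ⟨e, he, h⟩ := h
  revert e hwl hwr
  revert v
  exact Vtx.forall_of_list (by decide)

theorem tAdj_lt_of_hasVertex_AIVL (v : Vtx) (h : TileName.HasVertex ⟨.AIV, .L⟩ v)
    (hwl : v ≠ wl) (hwr : v ≠ wr) (hlt : v ≠ lt) : TileName.TAdj ⟨.AIV, .L⟩ lt v := by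
  obtain ⟨e, he, h⟩ := h
  revert e hwl hwr hlt
  revert v
  exact Vtx.forall_of_list (by decide)

/-- The number of tiles is `3 * (2 * k + 1)`, so residues modulo 3 survive the wrap-around. -/
theorem val_add_one_mod_three (i : Fin (2 * (3 * k + 1) + 1)) :
    (i + 1).val % 3 = (i.val + 1) % 3 := by
  rw [Fin.val_add, Fin.val_one', Nat.mod_eq_of_lt (a := 1) (by omega)]
  exact Nat.mod_mod_of_dvd _ ⟨2 * k + 1, by ring⟩

theorem dominationNumber_sharpSequence_le :
    dominationNumber (largeGraph (sharpSequence k)) ≤ 2 * (2 * k + 1) := by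
  classical
  set T := sharpSequence k with hT
  have hm : 1 ≤ 3 * k + 1 := by omega
  have hDD : ∀ i : Fin (2 * (3 * k + 1) + 1), i.val % 3 ≠ 2 → T i = ⟨.paths .D .D, .L⟩ :=
    fun i h => if_neg h
  have hAIV : ∀ i : Fin (2 * (3 * k + 1) + 1), i.val % 3 = 2 → T i = ⟨.AIV, .L⟩ :=
    fun i h => if_pos h
  have hL : ∀ i, (T i).frame = .L := fun i => by
    by_cases h : i.val % 3 = 2
    · rw [hAIV i h]
    · rw [hDD i h]
  have rep_tr : ∀ i, glueRep T (i, tr) = (i + 1, bl) := fun i => by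
    have := glueRep_rightTop T i
    rwa [hL i] at this
  have rep_lt : ∀ i, glueRep T (i, lt) = (i, lt) := fun i =>
    glueRep_of_ne T i (by decide) ((T i).rightTop_ne (by decide) (by decide))
  let a (q : Fin (2 * k + 1)) : Fin (2 * (3 * k + 1) + 1) := ⟨3 * q.val, by omega⟩
  let c (q : Fin (2 * k + 1)) : Fin (2 * (3 * k + 1) + 1) := ⟨3 * q.val + 2, by omega⟩
  let f (q : Fin (2 * k + 1)) :
      {v : (twistedCyclization T).V // (twistedCyclization T).degree v ≠ 2} :=
    ⟨vertexOf T (a q) tr (sharpSequence_hasVertex_tr k _),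
      degree_of_ne_wl T hm _ (by rw [rep_vertexOf, rep_tr]; simp)⟩
  let g (q : Fin (2 * k + 1)) :
      {v : (twistedCyclization T).V // (twistedCyclization T).degree v ≠ 2} :=
    ⟨vertexOf T (c q) lt (sharpSequence_hasVertex_lt k (by simp only [c]; omega)),
      degree_of_ne_wl T hm _ (by rw [rep_vertexOf, rep_lt]; simp)⟩
  -- In period `q`, `f` picks the vertex shared by the two `DDL` tiles, which dominates `tl` and
  -- `br` of both, and `g` picks `lt` of `AIVL`, adjacent to all four corners of its square.
  let D := Finset.univ.image f ∪ Finset.univ.image g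
  have hf : ∀ i : Fin (2 * (3 * k + 1) + 1), i.val % 3 = 0 →
      ∃ u ∈ D, rep T u.1 = (i + 1, bl) := by
    intro i hi
    refine ⟨f ⟨i.val / 3, by omega⟩, Finset.mem_union_left _ (Finset.mem_image_of_mem _
      (Finset.mem_univ _)), ?_⟩
    have : a ⟨i.val / 3, by omega⟩ = i := Fin.ext (by simp only [a]; omega)
    simp only [f, rep_vertexOf, rep_tr, this]
  have hg : ∀ i : Fin (2 * (3 * k + 1) + 1), i.val % 3 = 2 →
      ∃ u ∈ D, rep T u.1 = (i, lt) := by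
    intro i hi
    refine ⟨g ⟨i.val / 3, by omega⟩, Finset.mem_union_right _ (Finset.mem_image_of_mem _
      (Finset.mem_univ _)), ?_⟩
    have : c ⟨i.val / 3, by omega⟩ = i := Fin.ext (by simp only [c]; omega)
    simp only [g, rep_vertexOf, rep_lt, this]
  have hcard : D.card ≤ 2 * (2 * k + 1) := by
    refine (Finset.card_union_le _ _).trans ?_
    have h1 := Finset.card_image_le (s := Finset.univ) (f := f)
    have h2 := Finset.card_image_le (s := Finset.univ) (f := g)
    rw [Finset.card_univ, Fintype.card_fin] at h1 h2
    omega
  have nbr_lt : ∀ i : Fin (2 * (3 * k + 1) + 1), i.val % 3 = 2 → ∀ v, (T i).TAdj lt v →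
      ∃ u ∈ D, RepAdj T (rep T u.1) (glueRep T (i, v)) := by
    intro i hi v hv
    obtain ⟨u, hu, h⟩ := hg i hi
    exact ⟨u, hu, by rw [h, ← rep_lt i]; exact RepAdj.of_tAdj T hv⟩
  have nbr_tr : ∀ i : Fin (2 * (3 * k + 1) + 1), i.val % 3 = 0 → ∀ v, (T i).TAdj tr v →
      ∃ u ∈ D, RepAdj T (rep T u.1) (glueRep T (i, v)) := by
    intro i hi v hv
    obtain ⟨u, hu, h⟩ := hf i hi
    exact ⟨u, hu, by rw [h, ← rep_tr i]; exact RepAdj.of_tAdj T hv⟩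
  have nbr_bl : ∀ i : Fin (2 * (3 * k + 1) + 1), i.val % 3 = 0 → ∀ v, (T (i + 1)).TAdj bl v →
      ∃ u ∈ D, RepAdj T (rep T u.1) (glueRep T (i + 1, v)) := by
    intro i hi v hv
    obtain ⟨u, hu, h⟩ := hf i hi
    exact ⟨u, hu, by rw [h, ← glueRep_bl T (i + 1)]; exact RepAdj.of_tAdj T hv⟩
  have dom : ∀ i v, (T i).HasVertex v → v ≠ wl → v ≠ wr →
      ∃ u ∈ D, rep T u.1 = glueRep T (i, v) ∨ RepAdj T (rep T u.1) (glueRep T (i, v)) := by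
    intro i v hv h1 h2
    obtain ⟨j, rfl⟩ : ∃ j, i = j + 1 := ⟨i - 1, (sub_add_cancel i 1).symm⟩
    have hj := val_add_one_mod_three k j
    have hj' := val_add_one_mod_three k (j + 1)
    obtain h | h | h : j.val % 3 = 0 ∨ j.val % 3 = 1 ∨ j.val % 3 = 2 := by omega
    · have e := hDD (j + 1) (by omega)
      rw [e] at hv
      rcases mem_of_hasVertex_DDL v hv h1 h2 with rfl | rfl | rfl | rfl
      · obtain ⟨u, hu, h⟩ := nbr_bl j h tl (by rw [e]; decide)
        exact ⟨u, hu, Or.inr h⟩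
      -- The `tr` of the second `DDL` is `bl` of the following `AIVL`, hence adjacent to its `lt`.
      · obtain ⟨u, hu, h⟩ := nbr_lt (j + 1 + 1) (by omega) bl
          (by rw [hAIV _ (by omega)]; decide)
        rw [glueRep_bl, ← rep_tr] at h
        exact ⟨u, hu, Or.inr h⟩
      · obtain ⟨u, hu, h⟩ := hf j h
        exact ⟨u, hu, Or.inl (by rw [h, glueRep_bl])⟩
      · obtain ⟨u, hu, h⟩ := nbr_bl j h br (by rw [e]; decide)
        exact ⟨u, hu, Or.inr h⟩
    · have e := hAIV (j + 1) (by omega)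
      rw [e] at hv
      by_cases hlt : v = lt
      · subst hlt
        obtain ⟨u, hu, h⟩ := hg (j + 1) (by omega)
        exact ⟨u, hu, Or.inl (by rw [h, rep_lt])⟩
      · obtain ⟨u, hu, h⟩ := nbr_lt (j + 1) (by omega) v
          (by rw [e]; exact tAdj_lt_of_hasVertex_AIVL v hv h1 h2 hlt)
        exact ⟨u, hu, Or.inr h⟩
    · have e := hDD (j + 1) (by omega)
      rw [e] at hv
      rcases mem_of_hasVertex_DDL v hv h1 h2 with rfl | rfl | rfl | rfl
      · obtain ⟨u, hu, h⟩ := nbr_tr (j + 1) (by omega) tl (by rw [e]; decide)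
        exact ⟨u, hu, Or.inr h⟩
      · obtain ⟨u, hu, h⟩ := hf (j + 1) (by omega)
        exact ⟨u, hu, Or.inl (by rw [h, rep_tr])⟩
      -- The `bl` of the first `DDL` is `tr` of the preceding `AIVL`.
      · obtain ⟨u, hu, h⟩ := nbr_lt j h tr (by rw [hAIV _ h]; decide)
        rw [rep_tr, ← glueRep_bl T] at h
        exact ⟨u, hu, Or.inr h⟩
      · obtain ⟨u, hu, h⟩ := nbr_tr (j + 1) (by omega) br (by rw [e]; decide)
        exact ⟨u, hu, Or.inr h⟩
  suffices hD : IsDominating (largeGraph T) D by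
    refine le_trans ?_ hcard
    unfold dominationNumber
    exact Nat.sInf_le ⟨D, hD, rfl⟩
  refine isDominating_of_repAdj T D fun x => ?_
  obtain ⟨i, v, hv, hx⟩ := exists_vertexOf T x.1
  have hne : (glueRep T (i, v)).2 ≠ wl := fun h =>
    x.2 ((degree_eq_two_iff T hm _).mpr (by rw [hx, rep_vertexOf, h]))
  obtain ⟨u, hu, h⟩ := dom i v hv (by rintro rfl; exact hne (by rw [glueRep_wl]))
    (by rintro rfl; exact hne (by rw [glueRep_wr]))
  rw [← rep_vertexOf T i v hv, ← hx] at h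
  exact ⟨u, hu, h.imp (fun h => Subtype.ext (rep_injective T h)) id⟩

end Sharp

end TwoCrossing

theorem theorem3p4 :
    (∀ m : ℕ, 1 ≤ m → ∀ T : Fin (2 * m + 1) → TwoCrossing.TileName,
      ⌈(2 / 3 : ℚ) * (TwoCrossing.numL T : ℚ)⌉₊ ≤
        TwoCrossing.dominationNumber (TwoCrossing.largeGraph T)) ∧
    (∀ k : ℕ, TwoCrossing.dominationNumber (TwoCrossing.largeGraph (TwoCrossing.sharpSequence k)) =
      ⌈(2 / 3 : ℚ) * (TwoCrossing.numL (TwoCrossing.sharpSequence k) : ℚ)⌉₊) := by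
  have lower : ∀ m : ℕ, 1 ≤ m → ∀ T : Fin (2 * m + 1) → TwoCrossing.TileName,
      ⌈(2 / 3 : ℚ) * (TwoCrossing.numL T : ℚ)⌉₊ ≤
        TwoCrossing.dominationNumber (TwoCrossing.largeGraph T) := by
    intro m hm T
    rw [Nat.ceil_le, TwoCrossing.numL_eq]
    have h : ((2 * (2 * m + 1) : ℕ) : ℚ) ≤
        ((3 * TwoCrossing.dominationNumber (TwoCrossing.largeGraph T) : ℕ) : ℚ) :=
      Nat.cast_le.mpr (TwoCrossing.two_mul_le_dominationNumber hm T)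
    push_cast at h ⊢
    linarith
  refine ⟨lower, fun k => le_antisymm ?_ (lower _ (by omega) _)⟩
  refine (TwoCrossing.dominationNumber_sharpSequence_le k).trans ?_
  rw [TwoCrossing.numL_eq, ← Nat.cast_le (α := ℚ)]
  refine le_trans (le_of_eq ?_) (Nat.le_ceil _)
  push_cast
  ring
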